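/- **Setting.** Let $d\ge 2$. For $u\in\mathbb S^{d-1}$ and $s\in\mathbb R$ let $H_{u,s}=\{y\in\mathbb R^d:\langle y,u\rangle=s\}$, and let $\mathbb H^{d-1}$ be the space of all hyperplanes of $\mathbb R^d$, with the $\sigma$-field generated by the sets $[C]:=\{H\in\mathbb H^{d-1}:H\cap C\neq\emptyset\}$, $C\subset\mathbb R^d$ compact. Let $\gamma>0$, let $\mathbb Q$ be an even probability measure on $\mathbb S^{d-1}$ that is not concentrated on a great subsphere, and let $\eta$ be a Poisson process on $\mathbb H^{d-1}$, regarded as a random set of hyperplanes, with intensity measure $$\lambda=\gamma\int_{\mathbb S^{d-1}}\int_{\mathbb R}\mathbf 1\{H_{u,s}\in\cdot\}\,ds\,\mathbb Q(du).$$ Let $\Phi$ be the set of all points $x$ with $\{x\}=H_1\cap\dots\cap H_d$ for some $H_1,\dots,H_d\in\eta$. Let $K\subset\mathbb R^d$ be a non-empty, convex and compact set. We say that $n\ge d$ points are in *general hyperplane position* if any $d$ of them are affinely independent and span the same hyperplane, which is called the hyperplane generated by the points. For $r\ge0$ let $K_r=\{x\in K^c:d(x,K)\le r\}$, where $d(x,K)=\min\{\|y-x\|:y\in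 K\}$. Put $T_0=0$ and $T_{n+1}=\min\{r>T_n:\Phi\cap(K_r\setminus K_{T_n})\ne\emptyset\}$. Let $\xi_n$ be the set of all hyperplanes $H$ with $H\cap K=\emptyset$ that contain $2d-1$ distinct points of $\Phi\cap K_{T_n}$ in general hyperplane position. For a hyperplane $H$ with $H\cap K=\emptyset$ let $H(K)$ be the closed half-space bounded by $H$ with $K\subset H(K)$. **The algorithm.** Stage $n\ge1$: check whether there are positive integers $k_1,\dots,k_{2d-1}$ and distinct hyperplanes $H_{i,j}\in\xi_n$ ($1\le i\le k_j$, $1\le j\le 2d-1$) such that, for each $j$, the boundary of $P_j=\bigcap_{i=1}^{k_j}H_{i,j}(K)$ is contained in $K_{T_n}$. If not, continue with stage $n+1$. If so, stop and return the set $\chi_n$ of all hyperplanes that intersect $K$ and are generated by $2d-1$ distinct points of $\Phi\cap K_{T_n}$ in general hyperplane position. Put $T=T_n$ and $\chi_T=\chi_n$ if the algorithm stops at stage $n$, and $T=\infty$ if it never stops. **Proposition.** On the event $\{T<\infty\}$ we have almost surely that $\chi_T=\eta\cap[K]$. That is, for almost every $\omega$, if $T(\omega)<\infty$ then $\chi_T(\omega)=\eta(\omega)\cap[K]$.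 -/

import Mathlib

open MeasureTheory ProbabilityTheory Set
open scoped ENNReal NNReal InnerProductSpace

namespace HyperplaneProcess

/-! ### Hyperplanes -/

/-- The Euclidean space `ℝ^d`. -/
abbrev E (d : ℕ) : Type := EuclideanSpace ℝ (Fin d)

/-- The unit sphere of `ℝ^d`. -/
abbrev UnitSphere (d : ℕ) : Type := Metric.sphere (0 : E d) 1

/-- The set `H_{u,s} = {y : ⟨y, u⟩ = s}`. -/
def hyperplaneSet {d : ℕ} (u : UnitSphere d) (s : ℝ) : Set (E d) :=
  {y | ⟪y, (u : E d)⟫_ℝ = s}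

/-- The space of all hyperplanes of `ℝ^d`. -/
def Hyperplane (d : ℕ) : Type :=
  {H : Set (E d) // ∃ (u : UnitSphere d) (s : ℝ), H = hyperplaneSet u s}

/-- The points of a hyperplane. -/
def Hyperplane.carrier {d : ℕ} (H : Hyperplane d) : Set (E d) := H.1

/-- `H_{u,s}` as an element of the space of hyperplanes. -/
def Hyperplane.mk {d : ℕ} (u : UnitSphere d) (s : ℝ) : Hyperplane d :=
  ⟨hyperplaneSet u s, u, s, rfl⟩

/-- `[K]`, the set of all hyperplanes that hit `K`. -/
def hitting {d : ℕ} (K : Set (E d)) : Set (Hyperplane d) :=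
  {H | (H.carrier ∩ K).Nonempty}

/-- The σ-field on the space of hyperplanes, generated by the sets `[K]` with `K` compact. -/
instance instMeasurableSpaceHyperplane (d : ℕ) : MeasurableSpace (Hyperplane d) :=
  MeasurableSpace.generateFrom {A | ∃ K : Set (E d), IsCompact K ∧ A = hitting K}

/-- The parametrization `(u, s) ↦ H_{u,s}` is measurable, so that the image measure in the
definition of the intensity measure below is a genuine image measure. -/
theorem measurable_mk (d : ℕ) :
    Measurable (fun p : UnitSphere d × ℝ => Hyperplane.mk p.1 p.2) := by
  refine measurable_generateFrom ?_
  rintro A ⟨K, hK, rfl⟩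
  have : CompactSpace K := isCompact_iff_compactSpace.mp hK
  have hc : IsClosed {q : K × (UnitSphere d × ℝ) |
      ⟪(q.1 : E d), (q.2.1 : E d)⟫_ℝ = q.2.2} := by
    refine isClosed_eq ?_ ?_ <;> fun_prop
  have h := (isClosedMap_snd_of_compactSpace (X := K) (Y := UnitSphere d × ℝ)) _ hc
  convert h.measurableSet using 1
  ext p
  constructor
  · rintro ⟨y, hy, hyK⟩
    exact ⟨(⟨y, hyK⟩, p), hy, rfl⟩
  · rintro ⟨⟨y, q⟩, hy, rfl⟩
    exact ⟨y, hy, y.2⟩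

/-! ### Poisson hyperplane processes -/

/-- The intensity measure `λ = γ ∫ ∫ 𝟙{H_{u,s} ∈ ·} ds Q(du)`. -/
noncomputable def intensityMeasure {d : ℕ} (γ : ℝ) (Q : Measure (UnitSphere d)) :
    Measure (Hyperplane d) :=
  ENNReal.ofReal γ • (Q.prod volume).map (fun p : UnitSphere d × ℝ => Hyperplane.mk p.1 p.2)

/-- `η` is a Poisson process with intensity measure `Λ`, regarded as a random set of points:
the number of points in a measurable set `A` is a random variable with a Poisson distribution
with parameter `Λ A` (almost surely infinite if `Λ A = ∞`), and the numbers of points in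
pairwise disjoint measurable sets are independent. -/
structure IsPoissonProcess {Ω X : Type*} [MeasurableSpace Ω] [MeasurableSpace X]
    (P : Measure Ω) (η : Ω → Set X) (Λ : Measure X) : Prop where
  measurable_count : ∀ A : Set X, MeasurableSet A → Measurable fun ω => (η ω ∩ A).encard
  poisson_count : ∀ A : Set X, MeasurableSet A → Λ A ≠ ∞ →
    P.map (fun ω => (η ω ∩ A).encard) =
      (poissonMeasure (Λ A).toNNReal).map (fun k : ℕ => (k : ℕ∞))
  infinite_count : ∀ A : Set X, MeasurableSet A → Λ A = ∞ →
    ∀ᵐ ω ∂P, (η ω ∩ A).encard = ⊤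
  indep_count : ∀ (n : ℕ) (A : Fin n → Set X), (∀ i, MeasurableSet (A i)) →
    Pairwise (fun i j => Disjoint (A i) (A j)) →
    iIndepFun (fun (i : Fin n) (ω : Ω) => (η ω ∩ A i).encard) P

/-- `Q` is an admissible directional distribution: an even probability measure on the unit
sphere that is not concentrated on a great subsphere. -/
structure IsDirectionalDistribution {d : ℕ} (Q : Measure (UnitSphere d)) : Prop where
  isProbability : IsProbabilityMeasure Q
  even : Q.map (fun u => -u) = Q
  not_great_subsphere : ∀ v : E d, v ≠ 0 → ¬ ∀ᵐ u : UnitSphere d ∂Q, ⟪(u : E d), v⟫_ℝ = 0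

/-- `Φ`, the set of all points `x` with `{x} = H_1 ∩ ⋯ ∩ H_d` for some `H_1, …, H_d` in the
given set of hyperplanes. -/
def intersectionPoints {d : ℕ} (η : Set (Hyperplane d)) : Set (E d) :=
  {x | ∃ H : Fin d → Hyperplane d, (∀ i, H i ∈ η) ∧ ⋂ i, (H i).carrier = {x}}

/-! ### The reconstruction algorithm

The algorithm works on a set `φ` of points. -/

/-- `n` points are in general hyperplane position if any `d` of them are affinely independent
and all choices of `d` of them have the same affine hull (used for `n ≥ d`). -/
def GeneralHyperplanePosition {d n : ℕ} (x : Fin n → E d) : Prop :=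
  (∀ f : Fin d ↪ Fin n, AffineIndependent ℝ (x ∘ f)) ∧
  ∀ f g : Fin d ↪ Fin n,
    affineSpan ℝ (Set.range (x ∘ f)) = affineSpan ℝ (Set.range (x ∘ g))

/-- The outer parallel set `K_r = {x ∈ Kᶜ : d(x, K) ≤ r}`; in particular `K_∞ = Kᶜ` if `K` is
non-empty. -/
def outerParallel {d : ℕ} (K : Set (E d)) (r : ℝ≥0∞) : Set (E d) :=
  {x | x ∉ K ∧ Metric.infEDist x K ≤ r}

/-- The times `T_n`: `T_0 = 0`, and `T_{n+1}` is the smallest `r > T_n` such that `φ` has a point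
in `K_r \ K_{T_n}` (`∞` if there is no such point). -/
noncomputable def scanTime {d : ℕ} (K φ : Set (E d)) : ℕ → ℝ≥0∞
  | 0 => 0
  | n + 1 => sInf {r : ℝ≥0∞ | scanTime K φ n < r ∧
      (φ ∩ (outerParallel K r \ outerParallel K (scanTime K φ n))).Nonempty}

/-- The points `φ ∩ K_{T_n}` that have been scanned at stage `n`. -/
noncomputable def scanned {d : ℕ} (K φ : Set (E d)) (n : ℕ) : Set (E d) :=
  φ ∩ outerParallel K (scanTime K φ n)

/-- `ξ_n`, the set of all hyperplanes that do not hit `K` and contain `2d-1` distinct points of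
`φ ∩ K_{T_n}` in general hyperplane position. -/
def reconstructed {d : ℕ} (K φ : Set (E d)) (n : ℕ) : Set (Hyperplane d) :=
  {H | H.carrier ∩ K = ∅ ∧ ∃ x : Fin (2 * d - 1) → E d, Function.Injective x ∧
    (∀ i, x i ∈ scanned K φ n) ∧ (∀ i, x i ∈ H.carrier) ∧ GeneralHyperplanePosition x}

/-- `H(K)`, the closed half-space bounded by `H` that contains `K`. (If `K` is non-empty and
convex and `H ∩ K = ∅`, then exactly one of the two representations `H = H_{u,s}` satisfies
`K ⊆ {⟨·, u⟩ ≤ s}`.) -/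
def halfSpace {d : ℕ} (H : Hyperplane d) (K : Set (E d)) : Set (E d) :=
  {y | ∃ (u : UnitSphere d) (s : ℝ), H.carrier = hyperplaneSet u s ∧
    (∀ z ∈ K, ⟪z, (u : E d)⟫_ℝ ≤ s) ∧ ⟪y, (u : E d)⟫_ℝ ≤ s}

/-- The stopping criterion of stage `n ≥ 1`: there are positive integers `k_1, …, k_{2d-1}` and
distinct `H_{i,j} ∈ ξ_n` (`1 ≤ i ≤ k_j`, `1 ≤ j ≤ 2d-1`) such that, for each `j`, the boundary of
`P_j = ⋂ i, H_{i,j}(K)` is contained in `K_{T_n}`. -/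
def StopsAt {d : ℕ} (K φ : Set (E d)) (n : ℕ) : Prop :=
  1 ≤ n ∧ ∃ k : Fin (2 * d - 1) → ℕ, (∀ j, 1 ≤ k j) ∧
    ∃ H : (j : Fin (2 * d - 1)) → Fin (k j) → Hyperplane d,
      (∀ j i, H j i ∈ reconstructed K φ n) ∧
      Function.Injective (fun p : (j : Fin (2 * d - 1)) × Fin (k j) => H p.1 p.2) ∧
      ∀ j, frontier (⋂ i, halfSpace (H j i) K) ⊆ outerParallel K (scanTime K φ n)

/-- `χ_n`, the set of all hyperplanes that hit `K` and are generated by `2d-1` distinct points of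
`φ ∩ K_{T_n}` in general hyperplane position. -/
def returned {d : ℕ} (K φ : Set (E d)) (n : ℕ) : Set (Hyperplane d) :=
  {H | H ∈ hitting K ∧ ∃ x : Fin (2 * d - 1) → E d, Function.Injective x ∧
    (∀ i, x i ∈ scanned K φ n) ∧ GeneralHyperplanePosition x ∧
    H.carrier = (affineSpan ℝ (Set.range x) : Set (E d))}

open Classical in
/-- The running time `T`: it is `T_n` if the algorithm stops at stage `n` (the first stage at
which the stopping criterion holds), and `∞` if the algorithm never stops. -/
noncomputable def runningTime {d : ℕ} (K φ : Set (E d)) : ℝ≥0∞ :=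
  if h : ∃ n, StopsAt K φ n then scanTime K φ (Nat.find h) else ∞

open Classical in
/-- The output `χ_T`: it is `χ_n` if the algorithm stops at stage `n`. (The empty set stands for
the missing output of an algorithm that never stops.) -/
noncomputable def output {d : ℕ} (K φ : Set (E d)) : Set (Hyperplane d) :=
  if h : ∃ n, StopsAt K φ n then returned K φ (Nat.find h) else ∅

end HyperplaneProcess

/-! The probability is confined to one deterministic property, `NoCoincidence`: no hyperplane of `η`
passes through a point already determined by other hyperplanes of `η`. It holds almost surely
because a fixed point lies on a hyperplane only for a `λ`-null set of hyperplanes; Fubini, together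
with a covering argument for tuples of distinct points of the process
(`IsPoissonProcess.ae_forall_injective_notMem`), extends this to points depending measurably on
finitely many other hyperplanes.

No false hyperplane is found (`NoCoincidence.mem_of_generalHyperplanePosition`). Suppose `H ∉ η`
contains `2d-1` intersection points in general hyperplane position. Each `G ∈ η` contains at most
`d-1` of them, so at least `d` avoid `G` and still span `H`. One of the points is the intersection
of `d` members of `η`; inside `H`, of dimension `d-1`, one of these is redundant (`exists_omit`).
The point is then determined without the redundant hyperplane, yet lies on it.

No hyperplane hitting `K` is missed (`NoCoincidence.returned_eq`). Such an `H ∈ η` cuts each of the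
`2d-1` polytopes, and an extreme point of the section is a scanned vertex determined by `H` and
`d-1` facet hyperplanes (`exists_vertex`). If `d` of these vertices were affinely dependent, one
would lie in a flat of dimension at most `d-2` spanned by the others, so one of its facet
hyperplanes would again be redundant. -/

namespace HyperplaneProcess

/-! ### Null sets of tuples of points of a Poisson process -/

section Poisson

lemma setOf_inter_nonempty_eq {Ω X : Type*} (η : Ω → Set X) (A : Set X) :
    {ω | (η ω ∩ A).Nonempty} = (fun ω => (η ω ∩ A).encard) ⁻¹' {0}ᶜ := by
  ext ω
  simp [Set.nonempty_iff_ne_empty]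

variable {Ω X : Type*} [MeasurableSpace Ω] [MeasurableSpace X] {P : Measure Ω} {η : Ω → Set X}
  {Λ : Measure X}

/-- This is `1 - exp (-t) ≤ t` with `t = Λ A`. -/
lemma IsPoissonProcess.measure_nonempty_le (hη : IsPoissonProcess P η Λ)
    {A : Set X} (hA : MeasurableSet A) : P {ω | (η ω ∩ A).Nonempty} ≤ Λ A := by
  by_cases hfin : Λ A = ∞
  · simp [hfin]
  rw [setOf_inter_nonempty_eq, ← Measure.map_apply (hη.measurable_count A hA)
    (measurableSet_singleton _).compl, hη.poisson_count A hA hfin,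
    Measure.map_apply .of_discrete (measurableSet_singleton _).compl]
  have hpre : (fun k : ℕ => (k : ℕ∞)) ⁻¹' {0}ᶜ = {0}ᶜ := by ext k; simp
  rw [hpre, prob_compl_eq_one_sub (measurableSet_singleton _), poissonMeasure_singleton]
  rw [tsub_le_iff_right]
  nth_rewrite 1 [← ENNReal.coe_toNNReal hfin]
  rw [← ENNReal.ofReal_coe_nnreal, ← ENNReal.ofReal_add (by positivity) (by positivity),
    ENNReal.one_le_ofReal]
  have := Real.add_one_le_exp (-((Λ A).toNNReal : ℝ))
  simp only [pow_zero, mul_one, Nat.factorial_zero, Nat.cast_one, div_one]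
  linarith

/-- A Poisson process hits all of finitely many disjoint sets with probability at most the product
of the intensities. -/
lemma IsPoissonProcess.measure_forall_nonempty_le (hη : IsPoissonProcess P η Λ) {n : ℕ}
    {A : Fin n → Set X} (hA : ∀ i, MeasurableSet (A i))
    (hd : Pairwise fun i j => Disjoint (A i) (A j)) :
    P {ω | ∀ i, (η ω ∩ A i).Nonempty} ≤ ∏ i, Λ (A i) := by
  have h := (hη.indep_count n A hA hd).measure_inter_preimage_eq_mul Finset.univ
    (sets := fun _ => {0}ᶜ) (fun _ _ => (measurableSet_singleton _).compl)
  simp only [← setOf_inter_nonempty_eq] at h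
  have hset : {ω | ∀ i, (η ω ∩ A i).Nonempty} =
      ⋂ i ∈ (Finset.univ : Finset (Fin n)), {ω | (η ω ∩ A i).Nonempty} := by
    ext ω
    simp
  rw [hset, h]
  exact Finset.prod_le_prod' fun i _ => hη.measure_nonempty_le (hA i)

/-- The outer measure behind `Measure.pi` is an infimum over countable covers of the products of the
measures of the projections. Measurable hulls of these projections give the boxes. -/
lemma exists_cover_of_measure_pi_eq_zero {ι : Type*} [Fintype ι] [Nonempty ι] {N : Set (ι → X)}
    (hN : Measure.pi (fun _ => Λ) N = 0) {ε : ℝ≥0∞} (hε : 0 < ε) :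
    ∃ B : ℕ → ι → Set X, (∀ k i, MeasurableSet (B k i)) ∧
      (∀ F ∈ N, ∃ k, ∀ i, F i ∈ B k i) ∧ ∑' k, ∏ i, Λ (B k i) ≤ ε := by
  have h0 : (OuterMeasure.pi fun _ : ι => Λ.toOuterMeasure) N = 0 := by
    rw [Measure.pi] at hN
    exact le_antisymm ((le_toMeasure_apply _ _ _).trans hN.le) bot_le
  rw [OuterMeasure.pi, OuterMeasure.boundedBy_apply] at h0
  have hlt := h0.trans_lt hε
  simp only [iInf_lt_iff] at hlt
  obtain ⟨t, ht, hsum⟩ := hlt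
  refine ⟨fun k i => toMeasurable Λ (Function.eval i '' t k),
    fun k i => measurableSet_toMeasurable _ _, fun F hF => ?_, ?_⟩
  · obtain ⟨k, hk⟩ := mem_iUnion.1 (ht hF)
    exact ⟨k, fun i => subset_toMeasurable _ _ ⟨F, hk, rfl⟩⟩
  · refine le_trans (ENNReal.tsum_le_tsum fun k => ?_) hsum.le
    simp only [measure_toMeasurable]
    -- `boundedBy` charges only nonempty sets; for an empty one the product vanishes because `ι` is
    -- nonempty.
    rcases (t k).eq_empty_or_nonempty with hk | hk
    · simp [hk]
    · simp [hk, piPremeasure]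

/-- Union bound over a cover of `N` by boxes of total mass at most `ε`: cutting the sides with the
disjoint `A i` makes the counts independent. -/
lemma IsPoissonProcess.ae_forall_notMem_of_disjoint (hη : IsPoissonProcess P η Λ) {n : ℕ}
    {N : Set (Fin (n + 1) → X)} (hN : Measure.pi (fun _ => Λ) N = 0) {A : Fin (n + 1) → Set X}
    (hA : ∀ i, MeasurableSet (A i)) (hd : Pairwise fun i j => Disjoint (A i) (A j)) :
    ∀ᵐ ω ∂P, ∀ F : Fin (n + 1) → X, (∀ i, F i ∈ η ω) → (∀ i, F i ∈ A i) → F ∉ N := by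
  rw [ae_iff]
  refine le_antisymm (le_of_forall_pos_le_add fun ε hε => ?_) bot_le
  rw [zero_add]
  obtain ⟨B, hB, hcov, hsum⟩ := exists_cover_of_measure_pi_eq_zero hN hε
  calc P {ω | ¬ ∀ F : Fin (n + 1) → X, (∀ i, F i ∈ η ω) → (∀ i, F i ∈ A i) → F ∉ N}
      ≤ P (⋃ k, {ω | ∀ i, (η ω ∩ (B k i ∩ A i)).Nonempty}) := by
        refine measure_mono fun ω hω => ?_
        simp only [mem_ofPred_eq, not_forall, not_not] at hω
        obtain ⟨F, hF, hFA, hFN⟩ := hω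
        obtain ⟨k, hk⟩ := hcov F hFN
        exact mem_iUnion.2 ⟨k, fun i => ⟨F i, hF i, hk i, hFA i⟩⟩
    _ ≤ ∑' k, P {ω | ∀ i, (η ω ∩ (B k i ∩ A i)).Nonempty} := measure_iUnion_le _
    _ ≤ ∑' k, ∏ i, Λ (B k i) := by
        refine ENNReal.tsum_le_tsum fun k => ?_
        refine (hη.measure_forall_nonempty_le (fun i => (hB k i).inter (hA i))
          fun i j hij => (hd hij).mono inter_subset_right inter_subset_right).trans ?_
        exact Finset.prod_le_prod' fun i _ => measure_mono inter_subset_left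
    _ ≤ ε := hsum

/-- Almost surely, no tuple of distinct points of a Poisson process lies in a given null set of
the product of the intensity measure. -/
theorem IsPoissonProcess.ae_forall_injective_notMem (hη : IsPoissonProcess P η Λ)
    (hX : ∃ f : X → ℕ → Bool, Measurable f ∧ Function.Injective f) {n : ℕ}
    {N : Set (Fin (n + 1) → X)} (hN : Measure.pi (fun _ => Λ) N = 0) :
    ∀ᵐ ω ∂P, ∀ F : Fin (n + 1) → X, (∀ i, F i ∈ η ω) → Function.Injective F → F ∉ N := by
  obtain ⟨f, hf, hinj⟩ := hX
  -- Cylinder sets of the first `m` bits. Finitely many distinct points are separated by finitely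
  -- many bits, so countably many choices of disjoint cells cover all injective tuples.
  let A (m : ℕ) (w : Fin m → Bool) : Set X := {x | ∀ k : Fin m, f x k = w k}
  have hA (m : ℕ) (w : Fin m → Bool) : MeasurableSet (A m w) := by
    simp only [A, ofPred_forall]
    exact MeasurableSet.iInter fun k =>
      ((measurable_pi_apply (k : ℕ)).comp hf) (measurableSet_singleton (w k))
  have key : ∀ᵐ ω ∂P, ∀ (m : ℕ) (w : Fin (n + 1) → Fin m → Bool), Function.Injective w →
      ∀ F : Fin (n + 1) → X, (∀ i, F i ∈ η ω) → (∀ i, F i ∈ A m (w i)) → F ∉ N := by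
    refine ae_all_iff.2 fun m => ae_all_iff.2 fun w => ?_
    by_cases hw : Function.Injective w
    · have hd : Pairwise fun i j => Disjoint (A m (w i)) (A m (w j)) := fun i j hij =>
        Set.disjoint_left.2 fun x hxi hxj =>
          hij (hw (funext fun k => (hxi k).symm.trans (hxj k)))
      filter_upwards [hη.ae_forall_notMem_of_disjoint hN (fun i => hA m _) hd] with ω hω _ using hω
    · exact Filter.Eventually.of_forall fun ω h => absurd h hw
  filter_upwards [key] with ω hω F hF hFinj
  have hsep : ∀ p : Fin (n + 1) × Fin (n + 1), ∃ k : ℕ, p.1 ≠ p.2 → f (F p.1) k ≠ f (F p.2) k := by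
    intro p
    by_cases hp : p.1 = p.2
    · exact ⟨0, fun h => absurd hp h⟩
    · obtain ⟨k, hk⟩ := Function.ne_iff.1 (fun h => hp (hFinj (hinj h)))
      exact ⟨k, fun _ => hk⟩
  choose k hk using hsep
  refine hω (Finset.univ.sup k + 1) (fun i j => f (F i) j) (fun i j hij => ?_) F hF
    fun i j => rfl
  by_contra hne
  exact hk (i, j) hne (congrFun hij ⟨k (i, j), Nat.lt_succ_of_le (Finset.le_sup (Finset.mem_univ _))⟩)

/-- Almost surely, no point of a Poisson process lies in the null set which is determined by
finitely many other points. -/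
theorem IsPoissonProcess.ae_forall_notMem_section [SigmaFinite Λ] (hη : IsPoissonProcess P η Λ)
    (hX : ∃ f : X → ℕ → Bool, Measurable f ∧ Function.Injective f) {ι : Type*} [Finite ι]
    {N : Set (X × (ι → X))} (hN : MeasurableSet N)
    (hnull : ∀ F, Λ {x | (x, F) ∈ N} = 0) :
    ∀ᵐ ω ∂P, ∀ F : ι → X, (∀ i, F i ∈ η ω) → ∀ x ∈ η ω, x ∉ range F → (x, F) ∉ N := by
  classical
  -- `F` may repeat values. `G` lists `x` followed by the distinct values of `F`, and `σ` records
  -- which value each index takes.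
  have key : ∀ᵐ ω ∂P, ∀ (n : ℕ) (σ : ι → Fin n) (G : Fin (n + 1) → X), (∀ i, G i ∈ η ω) →
      Function.Injective G → (G 0, fun i => G (σ i).succ) ∉ N := by
    refine ae_all_iff.2 fun n => ae_all_iff.2 fun σ => ?_
    let r : X × (Fin n → X) → X × (ι → X) := fun q => (q.1, fun i => q.2 (σ i))
    have hr : Measurable r := by
      refine measurable_fst.prodMk (measurable_pi_lambda _ fun i => ?_)
      exact (measurable_pi_apply _).comp measurable_snd
    refine hη.ae_forall_injective_notMem hX
      (N := {G : Fin (n + 1) → X | (G 0, fun i => G (σ i).succ) ∈ N}) ?_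
    have hmp := measurePreserving_piFinSuccAbove (fun _ : Fin (n + 1) => Λ) 0
    have hpre : {G : Fin (n + 1) → X | (G 0, fun i => G (σ i).succ) ∈ N} =
        MeasurableEquiv.piFinSuccAbove (fun _ => X) 0 ⁻¹' (r ⁻¹' N) := rfl
    rw [hpre, hmp.measure_preimage (hr hN).nullMeasurableSet, Measure.prod_apply_symm (hr hN)]
    refine (lintegral_congr fun y => ?_).trans lintegral_zero
    exact hnull fun i => y (σ i)
  filter_upwards [key] with ω hω F hF x hx hxF
  have hfin : (range F).Finite := finite_range F
  let := hfin.fintype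
  let e : range F ≃ Fin (Fintype.card (range F)) := Fintype.equivFin _
  have := hω _ (fun i => e ⟨F i, mem_range_self i⟩)
    (Fin.cons x fun j => (e.symm j : X)) (fun i => ?_) ?_
  · simpa using this
  · refine Fin.cases hx (fun j => ?_) i
    obtain ⟨i, hi⟩ := (e.symm j).2
    rw [Fin.cons_succ, ← hi]
    exact hF i
  · rw [Fin.cons_injective_iff]
    refine ⟨?_, Subtype.val_injective.comp e.symm.injective⟩
    rintro ⟨j, hj⟩
    exact hxF (hj ▸ (e.symm j).2)

end Poisson

/-! ### Normal vectors and the measurable structure of the space of hyperplanes -/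

section Hyperplane

variable {d : ℕ}

/-- A unit normal vector of a hyperplane. -/
noncomputable def Hyperplane.normal (H : Hyperplane d) : E d := (H.2.choose : E d)

/-- The offset of a hyperplane with respect to `Hyperplane.normal`. -/
noncomputable def Hyperplane.offset (H : Hyperplane d) : ℝ := H.2.choose_spec.choose

lemma Hyperplane.mem_carrier (H : Hyperplane d) {x : E d} :
    x ∈ H.carrier ↔ ⟪x, H.normal⟫_ℝ = H.offset := by
  have h : H.carrier = hyperplaneSet H.2.choose H.offset := H.2.choose_spec.choose_spec
  rw [h]
  rfl

lemma Hyperplane.norm_normal (H : Hyperplane d) : ‖H.normal‖ = 1 :=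
  norm_eq_of_mem_sphere H.2.choose

lemma Hyperplane.inner_normal_self (H : Hyperplane d) : ⟪H.normal, H.normal⟫_ℝ = 1 := by
  rw [real_inner_self_eq_norm_sq, H.norm_normal, one_pow]

lemma Hyperplane.normal_ne_zero (H : Hyperplane d) : H.normal ≠ 0 :=
  norm_ne_zero_iff.1 (by simp [H.norm_normal])

lemma Hyperplane.carrier_injective :
    Function.Injective (Hyperplane.carrier : Hyperplane d → Set (E d)) :=
  Subtype.val_injective

lemma inner_eq_sum (x y : E d) : ⟪x, y⟫_ℝ = ∑ j, y j * x j := by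
  simp [PiLp.inner_apply]

/-- The chosen normal carries an arbitrary sign. Multiplying the equation by `H.normal i` leaves
only coefficients invariant under `(u, s) ↦ (-u, -s)`, which can be shown to be measurable. -/
lemma Hyperplane.mem_carrier_iff_coord (H : Hyperplane d) {x : E d} :
    x ∈ H.carrier ↔
      ∀ i, ∑ j, H.normal i * H.normal j * x j = H.offset * H.normal i := by
  have hsum (i : Fin d) : ∑ j, H.normal i * H.normal j * x j = ⟪x, H.normal⟫_ℝ * H.normal i := by
    rw [inner_eq_sum, Finset.sum_mul]
    exact Finset.sum_congr rfl fun j _ => by ring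
  simp only [hsum]
  rw [H.mem_carrier]
  refine ⟨fun h i => by rw [h], fun h => ?_⟩
  obtain ⟨i, hi⟩ : ∃ i, H.normal i ≠ 0 := by
    by_contra! hne
    exact H.normal_ne_zero (by ext i; simpa using hne i)
  exact mul_right_cancel₀ hi (h i)

lemma hitting_closedBall (x : E d) (r : ℝ) :
    hitting (Metric.closedBall x r) = {H : Hyperplane d | |⟪x, H.normal⟫_ℝ - H.offset| ≤ r} := by
  ext H
  constructor
  · rintro ⟨y, hy, hyx⟩
    rw [H.mem_carrier] at hy
    rw [mem_ofPred_eq, ← hy, ← inner_sub_left]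
    refine (abs_real_inner_le_norm _ _).trans ?_
    rw [H.norm_normal, mul_one, ← dist_eq_norm, dist_comm]
    exact hyx
  · intro h
    refine ⟨x - (⟪x, H.normal⟫_ℝ - H.offset) • H.normal, ?_, ?_⟩
    · rw [H.mem_carrier, inner_sub_left, inner_smul_left, H.inner_normal_self]
      simp
    · rw [Metric.mem_closedBall, dist_eq_norm]
      simpa [norm_smul, H.norm_normal] using h

lemma measurableSet_hitting {C : Set (E d)} (hC : IsCompact C) :
    MeasurableSet (hitting C : Set (Hyperplane d)) :=
  MeasurableSpace.measurableSet_generateFrom ⟨C, hC, rfl⟩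

lemma measurable_abs_inner_sub_offset (x : E d) :
    Measurable fun H : Hyperplane d => |⟪x, H.normal⟫_ℝ - H.offset| := by
  refine measurable_of_Iic fun r => ?_
  have := measurableSet_hitting (isCompact_closedBall x r)
  rwa [hitting_closedBall] at this

lemma measurable_sq_inner_sub_offset (x : E d) :
    Measurable fun H : Hyperplane d => (⟪x, H.normal⟫_ℝ - H.offset) ^ 2 := by
  have h := (measurable_abs_inner_sub_offset x).pow_const 2
  convert h using 2 with H
  exact (sq_abs _).symm

/-- Polarization: squared distances from points to `H` are measurable, since hitting a ball is a
bound on the distance, and their combinations yield all sign-invariant quadratic expressions. -/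
lemma measurable_offset_mul_inner (x : E d) :
    Measurable fun H : Hyperplane d => H.offset * ⟪x, H.normal⟫_ℝ := by
  have h := ((measurable_sq_inner_sub_offset (-x)).sub
    (measurable_sq_inner_sub_offset x)).div_const 4
  convert h using 2 with H
  simp only [Pi.sub_apply, inner_neg_left]
  ring

lemma measurable_inner_sq (x : E d) :
    Measurable fun H : Hyperplane d => ⟪x, H.normal⟫_ℝ ^ 2 := by
  have h := (((measurable_sq_inner_sub_offset (-x)).add
    (measurable_sq_inner_sub_offset x)).div_const 2).sub (measurable_sq_inner_sub_offset 0)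
  convert h using 2 with H
  simp only [Pi.sub_apply, Pi.add_apply, inner_neg_left, inner_zero_left]
  ring

lemma measurable_inner_mul_inner (x y : E d) :
    Measurable fun H : Hyperplane d => ⟪x, H.normal⟫_ℝ * ⟪y, H.normal⟫_ℝ := by
  have h := ((measurable_inner_sq (x + y)).sub (measurable_inner_sq (x - y))).div_const 4
  convert h using 2 with H
  simp only [Pi.sub_apply, inner_add_left, inner_sub_left]
  ring

lemma inner_single_one (i : Fin d) (v : E d) :
    ⟪(EuclideanSpace.single i 1 : E d), v⟫_ℝ = v i := by
  rw [EuclideanSpace.inner_single_left]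
  simp

@[fun_prop]
lemma measurable_normal_mul_normal (i j : Fin d) :
    Measurable fun H : Hyperplane d => H.normal i * H.normal j := by
  simpa only [inner_single_one] using
    measurable_inner_mul_inner (EuclideanSpace.single i 1 : E d) (EuclideanSpace.single j 1)

@[fun_prop]
lemma measurable_offset_mul_normal (i : Fin d) :
    Measurable fun H : Hyperplane d => H.offset * H.normal i := by
  simpa only [inner_single_one] using
    measurable_offset_mul_inner (EuclideanSpace.single i 1 : E d)

lemma exists_measurable_injection_hyperplane (d : ℕ) :
    ∃ f : Hyperplane d → ℕ → Bool, Measurable f ∧ Function.Injective f := by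
  let φ : Hyperplane d → (Fin d → Fin d → ℝ) × (Fin d → ℝ) :=
    fun H => (fun i j => H.normal i * H.normal j, fun i => H.offset * H.normal i)
  have hφ : Measurable φ := by fun_prop
  have hinj : Function.Injective φ := by
    intro H G h
    have h1 (i j : Fin d) : H.normal i * H.normal j = G.normal i * G.normal j :=
      congrFun (congrFun (congrArg Prod.fst h) i) j
    have h2 (i : Fin d) : H.offset * H.normal i = G.offset * G.normal i :=
      congrFun (congrArg Prod.snd h) i
    refine Hyperplane.carrier_injective (Set.ext fun x => ?_)
    simp only [Hyperplane.mem_carrier_iff_coord, h1, h2]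
  obtain ⟨f, hf, hfi⟩ := MeasurableSpace.measurable_injection_nat_bool_of_countablySeparated
    ((Fin d → Fin d → ℝ) × (Fin d → ℝ))
  exact ⟨f ∘ φ, hf.comp hφ, hfi.comp hinj⟩

/-! ### The intensity measure -/

lemma mk_mem_hitting_singleton {u : UnitSphere d} {s : ℝ} {x : E d} :
    Hyperplane.mk u s ∈ hitting {x} ↔ ⟪x, (u : E d)⟫_ℝ = s := by
  change (hyperplaneSet u s ∩ {x}).Nonempty ↔ _
  rw [inter_singleton_nonempty]
  rfl

/-- For each direction exactly one offset gives a hyperplane through `x`. -/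
lemma intensityMeasure_hitting_singleton (γ : ℝ) (Q : Measure (UnitSphere d)) [SFinite Q]
    (x : E d) : intensityMeasure γ Q (hitting {x}) = 0 := by
  have hm := measurableSet_hitting (isCompact_singleton (x := x))
  rw [intensityMeasure, Measure.smul_apply, Measure.map_apply (measurable_mk d) hm,
    Measure.prod_apply (measurable_mk d hm)]
  have hslice (u : UnitSphere d) : Prod.mk u ⁻¹'
      ((fun p : UnitSphere d × ℝ => Hyperplane.mk p.1 p.2) ⁻¹' hitting {x}) =
        {⟪x, (u : E d)⟫_ℝ} := by
    ext s
    simp only [mem_preimage, mk_mem_hitting_singleton, mem_singleton_iff]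
    exact eq_comm
  simp [hslice]

lemma intensityMeasure_hitting_closedBall_lt_top (γ : ℝ) (Q : Measure (UnitSphere d))
    [IsFiniteMeasure Q] (r : ℝ) :
    intensityMeasure γ Q (hitting (Metric.closedBall 0 r)) < ∞ := by
  have hm := measurableSet_hitting (isCompact_closedBall (0 : E d) r)
  rw [intensityMeasure, Measure.smul_apply, Measure.map_apply (measurable_mk d) hm]
  refine ENNReal.mul_lt_top ENNReal.ofReal_lt_top ?_
  refine lt_of_le_of_lt (measure_mono (t := univ ×ˢ Icc (-r) r) ?_) ?_
  · rintro ⟨u, s⟩ ⟨y, hy, hyr⟩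
    have hy : ⟪y, (u : E d)⟫_ℝ = s := hy
    refine ⟨mem_univ _, abs_le.1 ?_⟩
    rw [← hy]
    refine (abs_real_inner_le_norm _ _).trans ?_
    rw [norm_eq_of_mem_sphere u, mul_one]
    simpa using hyr
  · rw [Measure.prod_prod]
    exact ENNReal.mul_lt_top (measure_lt_top _ _) (by simp)

instance sigmaFinite_intensityMeasure (γ : ℝ) (Q : Measure (UnitSphere d)) [IsFiniteMeasure Q] :
    SigmaFinite (intensityMeasure γ Q) := by
  refine ⟨⟨⟨fun n : ℕ => hitting (Metric.closedBall 0 n), fun _ => trivial,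
    fun n => intensityMeasure_hitting_closedBall_lt_top γ Q n, ?_⟩⟩⟩
  refine eq_univ_of_forall fun H => ?_
  obtain ⟨n, hn⟩ := exists_nat_ge |⟪(0 : E d), H.normal⟫_ℝ - H.offset|
  refine mem_iUnion.2 ⟨n, ?_⟩
  rw [hitting_closedBall]
  exact hn

/-- Almost surely, no hyperplane of a Poisson hyperplane process contains a point which is
determined measurably by finitely many other hyperplanes of the process. -/
theorem IsPoissonProcess.ae_forall_point_notMem {Ω : Type*} [MeasurableSpace Ω] {P : Measure Ω}
    {γ : ℝ} {Q : Measure (UnitSphere d)} [IsFiniteMeasure Q] {η : Ω → Set (Hyperplane d)}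
    (hη : IsPoissonProcess P η (intensityMeasure γ Q)) {ι : Type*} [Finite ι]
    {p : (ι → Hyperplane d) → Fin d → ℝ} (hp : ∀ j, Measurable fun F => p F j) :
    ∀ᵐ ω ∂P, ∀ F : ι → Hyperplane d, (∀ i, F i ∈ η ω) → ∀ G ∈ η ω, G ∉ range F →
      WithLp.toLp 2 (p F) ∉ G.carrier := by
  refine hη.ae_forall_notMem_section (exists_measurable_injection_hyperplane d)
    (N := {q : Hyperplane d × (ι → Hyperplane d) | WithLp.toLp 2 (p q.2) ∈ q.1.carrier})
    ?_ fun F => ?_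
  · simp only [Hyperplane.mem_carrier_iff_coord, ofPred_forall]
    refine MeasurableSet.iInter fun i => measurableSet_eq_fun ?_ ?_
    · refine Finset.measurable_sum _ fun j _ => ?_
      exact ((measurable_normal_mul_normal i j).comp measurable_fst).mul
        ((hp j).comp measurable_snd)
    · exact (measurable_offset_mul_normal i).comp measurable_fst
  · convert intensityMeasure_hitting_singleton γ Q (WithLp.toLp 2 (p F)) using 2
    ext H
    simp [hitting]

end Hyperplane

/-! ### Measurable solutions of linear systems -/

section LeastSquares

variable {m n : Type*} [Fintype m] [Fintype n] [DecidableEq n]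

/-- The least squares solution of `A t = b`. -/
noncomputable def leastSquares (A : Matrix m n ℝ) (b : m → ℝ) : n → ℝ :=
  (A.transpose * A)⁻¹.mulVec (A.transpose.mulVec b)

/-- `Aᵀ A` has the same kernel as `A`. The explicit formula solves an overdetermined consistent
system by an expression that is measurable in its data. -/
lemma leastSquares_eq {A : Matrix m n ℝ} {b : m → ℝ} {t : n → ℝ}
    (hA : ∀ v, A.mulVec v = 0 → v = 0) (ht : A.mulVec t = b) : leastSquares A b = t := by
  have hinj : Function.Injective (A.transpose * A).mulVec := by
    change Function.Injective (A.transpose * A).mulVecLin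
    rw [← LinearMap.ker_eq_bot, Matrix.ker_mulVecLin_transpose_mul_self, LinearMap.ker_eq_bot']
    exact hA
  have hunit : IsUnit (A.transpose * A).det :=
    (Matrix.isUnit_iff_isUnit_det _).1 (Matrix.mulVec_injective_iff_isUnit.1 hinj)
  rw [leastSquares, ← ht, Matrix.mulVec_mulVec, Matrix.mulVec_mulVec,
    Matrix.mul_assoc, Matrix.nonsing_inv_mul _ hunit, Matrix.one_mulVec]

variable {X : Type*} [MeasurableSpace X]

omit [Fintype m] in
lemma measurable_det {A : X → Matrix n n ℝ} (hA : ∀ i j, Measurable fun x => A x i j) :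
    Measurable fun x => (A x).det := by
  simp only [Matrix.det_apply]
  exact Finset.measurable_sum _ fun σ _ =>
    (Finset.measurable_prod _ fun i _ => hA _ _).const_smul _

/-- The entries are cofactors divided by the determinant. Since inversion in `ℝ` is total, singular
matrices need no exception. -/
lemma measurable_inv_apply {A : X → Matrix n n ℝ} (hA : ∀ i j, Measurable fun x => A x i j)
    (i j : n) : Measurable fun x => (A x)⁻¹ i j := by
  simp only [Matrix.inv_def, Matrix.smul_apply, Matrix.adjugate_apply, Ring.inverse_eq_inv',
    smul_eq_mul]
  refine (measurable_det hA).inv.mul (measurable_det fun k l => ?_)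
  by_cases hk : k = j
  · subst hk
    simp
  · simpa [Matrix.updateRow_ne hk] using hA k l

lemma measurable_leastSquares {A : X → Matrix m n ℝ} {b : X → m → ℝ}
    (hA : ∀ i j, Measurable fun x => A x i j) (hb : ∀ i, Measurable fun x => b x i) (j : n) :
    Measurable fun x => leastSquares (A x) (b x) j := by
  simp only [leastSquares, Matrix.mulVec, dotProduct, Matrix.transpose_apply]
  refine Finset.measurable_sum _ fun k _ => (measurable_inv_apply (fun i l => ?_) j k).mul ?_
  · simp only [Matrix.mul_apply, Matrix.transpose_apply]
    exact Finset.measurable_sum _ fun a _ => (hA a i).mul (hA a l)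
  · exact Finset.measurable_sum _ fun a _ => (hA a k).mul (hb a)

end LeastSquares

/-! ### Points determined by finitely many hyperplanes -/

section Points

variable {d : ℕ}

/-- The coordinates of the common point of finitely many hyperplanes (if it is unique). -/
noncomputable def commonPoint {k : ℕ} (F : Fin k → Hyperplane d) : Fin d → ℝ :=
  leastSquares
    (Matrix.of fun (q : Fin k × Fin d) j => (F q.1).normal q.2 * (F q.1).normal j)
    (fun q => (F q.1).offset * (F q.1).normal q.2)

lemma commonPoint_eq {k : ℕ} {F : Fin k → Hyperplane d} {y : E d}
    (h : ⋂ i, (F i).carrier = {y}) : commonPoint F = y.ofLp := by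
  have hy (i : Fin k) : y ∈ (F i).carrier := mem_iInter.1 (h ▸ mem_singleton y) i
  refine leastSquares_eq (fun v hv => ?_) ?_
  · have hmem : y + WithLp.toLp 2 v ∈ ⋂ i, (F i).carrier := by
      refine mem_iInter.2 fun i => (F i).mem_carrier_iff_coord.2 fun a => ?_
      have h1 := (F i).mem_carrier_iff_coord.1 (hy i) a
      have h2 := congrFun hv (i, a)
      simp only [Matrix.mulVec, dotProduct, Matrix.of_apply, Pi.zero_apply] at h2
      simp only [PiLp.add_apply, mul_add, Finset.sum_add_distrib, h1, h2, add_zero]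
    rw [h, mem_singleton_iff, add_eq_left] at hmem
    simpa using hmem
  · ext ⟨i, a⟩
    exact (F i).mem_carrier_iff_coord.1 (hy i) a

lemma measurable_commonPoint {X : Type*} [MeasurableSpace X] {k : ℕ}
    {F : X → Fin k → Hyperplane d} (hF : ∀ i, Measurable fun x => F x i) (j : Fin d) :
    Measurable fun x => commonPoint (F x) j := by
  unfold commonPoint
  refine measurable_leastSquares (fun q l => ?_) (fun q => ?_) j
  · exact (measurable_normal_mul_normal q.2 l).comp (hF q.1)
  · exact (measurable_offset_mul_normal q.2).comp (hF q.1)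

/-- The matrix of the linear system for the coefficients `t` of an affine combination
`∑ a, t a • Y a` which lies in all hyperplanes `G i`. -/
noncomputable def spanMatrix {k l : ℕ} (Y : Fin l → Fin d → ℝ) (G : Fin k → Hyperplane d) :
    Matrix (Option (Fin k × Fin d)) (Fin l) ℝ
  | none, _ => 1
  | some q, a => ∑ j, (G q.1).normal q.2 * (G q.1).normal j * Y a j

/-- The right-hand side of the linear system with matrix `spanMatrix`. -/
noncomputable def spanVector {k : ℕ} (G : Fin k → Hyperplane d) : Option (Fin k × Fin d) → ℝ
  | none => 1
  | some q => (G q.1).offset * (G q.1).normal q.2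

/-- The coordinates of the common point of finitely many hyperplanes and the affine span of
the points `Y` (if it is unique). -/
noncomputable def spanSection {k l : ℕ} (Y : Fin l → Fin d → ℝ) (G : Fin k → Hyperplane d)
    (j : Fin d) : ℝ :=
  ∑ a, leastSquares (spanMatrix Y G) (spanVector G) a * Y a j

lemma spanMatrix_mulVec_none {k l : ℕ} (Y : Fin l → Fin d → ℝ) (G : Fin k → Hyperplane d)
    (v : Fin l → ℝ) : (spanMatrix Y G).mulVec v none = ∑ a, v a := by
  simp [Matrix.mulVec, dotProduct, spanMatrix]

lemma spanMatrix_mulVec_some {k l : ℕ} (y : Fin l → E d) (G : Fin k → Hyperplane d)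
    (v : Fin l → ℝ) (i : Fin k) (b : Fin d) :
    (spanMatrix (fun a => (y a).ofLp) G).mulVec v (some (i, b)) =
      ∑ j, (G i).normal b * (G i).normal j * (∑ a, v a • y a : E d) j := by
  simp only [Matrix.mulVec, dotProduct, spanMatrix, Finset.sum_mul, WithLp.ofLp_sum,
    Finset.sum_apply, PiLp.smul_apply, smul_eq_mul, Finset.mul_sum]
  rw [Finset.sum_comm]
  exact Finset.sum_congr rfl fun j _ => Finset.sum_congr rfl fun a _ => by ring

/-- The unknowns are barycentric coordinates. A kernel vector has coordinate sum zero and shifts `x`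
to another solution, so by uniqueness it encodes an affine relation among the `y a`, and affine
independence makes it zero. -/
lemma spanSection_eq {k l : ℕ} {y : Fin l → E d} {G : Fin k → Hyperplane d} {x : E d}
    (hy : AffineIndependent ℝ y) (hx : x ∈ affineSpan ℝ (range y)) (hxG : ∀ i, x ∈ (G i).carrier)
    (huniq : ∀ z ∈ affineSpan ℝ (range y), (∀ i, z ∈ (G i).carrier) → z = x) :
    spanSection (fun a => (y a).ofLp) G = x.ofLp := by
  obtain ⟨t, ht, hxt⟩ := eq_affineCombination_of_mem_affineSpan_of_fintype hx
  rw [Finset.affineCombination_eq_linear_combination _ _ _ ht] at hxt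
  have hls : leastSquares (spanMatrix (fun a => (y a).ofLp) G) (spanVector G) = t := by
    refine leastSquares_eq (fun v hv => ?_) ?_
    · have hv0 : ∑ a, v a = 0 := by
        rw [← spanMatrix_mulVec_none (fun a => (y a).ofLp) G, hv]
        rfl
      have htv : ∑ a, (t + v) a = 1 := by
        simp [Finset.sum_add_distrib, ht, hv0]
      have hz := huniq (∑ a, (t + v) a • y a) ?_ fun i => ?_
      · simp only [Pi.add_apply, add_smul, Finset.sum_add_distrib, ← hxt, add_eq_left] at hz
        ext a
        exact affineIndependent_iff.1 hy Finset.univ v hv0 hz a (Finset.mem_univ a)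
      · rw [← Finset.affineCombination_eq_linear_combination _ _ _ htv]
        exact affineCombination_mem_affineSpan htv y
      · refine (G i).mem_carrier_iff_coord.2 fun b => ?_
        have h1 := (G i).mem_carrier_iff_coord.1 (hxG i) b
        rw [hxt, ← spanMatrix_mulVec_some] at h1
        rw [← spanMatrix_mulVec_some, Matrix.mulVec_add, hv, add_zero, h1]
    · ext q
      rcases q with _ | ⟨i, b⟩
      · rw [spanMatrix_mulVec_none, ht]
        rfl
      · rw [spanMatrix_mulVec_some, ← hxt]
        exact (G i).mem_carrier_iff_coord.1 (hxG i) b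
  ext j
  simp [spanSection, hls, hxt]

lemma measurable_spanSection {X : Type*} [MeasurableSpace X] {k l : ℕ}
    {Y : X → Fin l → Fin d → ℝ} {G : X → Fin k → Hyperplane d}
    (hY : ∀ a j, Measurable fun x => Y x a j) (hG : ∀ i, Measurable fun x => G x i) (j : Fin d) :
    Measurable fun x => spanSection (Y x) (G x) j := by
  refine Finset.measurable_sum _ fun a _ => (measurable_leastSquares ?_ ?_ a).mul (hY a j)
  · rintro (_ | q) b
    · exact measurable_const
    · exact Finset.measurable_sum Finset.univ fun j _ =>
        ((measurable_normal_mul_normal q.2 j).comp (hG q.1)).mul (hY b j)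
  · rintro (_ | q)
    · exact measurable_const
    · exact (measurable_offset_mul_normal q.2).comp (hG q.1)

/-- No hyperplane of `η` passes through a point that is determined by other hyperplanes of `η`
as the only common point of finitely many of them and the affine span of finitely many of their
intersection points. -/
def NoCoincidence (η : Set (Hyperplane d)) : Prop :=
  ∀ G₀ ∈ η, ∀ S : Set (E d), S.Finite → S ⊆ intersectionPoints (η \ {G₀}) →
    ∀ T : Set (Hyperplane d), T.Finite → T ⊆ η \ {G₀} → ∀ x ∈ affineSpan ℝ S,
      (∀ G ∈ T, x ∈ G.carrier) →
      (∀ z ∈ affineSpan ℝ S, (∀ G ∈ T, z ∈ G.carrier) → z = x) → x ∉ G₀.carrier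

theorem IsPoissonProcess.ae_noCoincidence {Ω : Type*} [MeasurableSpace Ω] {P : Measure Ω}
    {γ : ℝ} {Q : Measure (UnitSphere d)} [IsFiniteMeasure Q] {η : Ω → Set (Hyperplane d)}
    (hη : IsPoissonProcess P η (intensityMeasure γ Q)) : ∀ᵐ ω ∂P, NoCoincidence (η ω) := by
  -- The index type provides `d` hyperplanes for each of `l` spanning points and `k` hyperplanes for
  -- `T`.
  have key : ∀ᵐ ω ∂P, ∀ (l k : ℕ) (F : (Fin l × Fin d) ⊕ Fin k → Hyperplane d),
      (∀ i, F i ∈ η ω) → ∀ G₀ ∈ η ω, G₀ ∉ range F →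
      WithLp.toLp 2 (spanSection (fun a => commonPoint fun b => F (.inl (a, b)))
        (fun i => F (.inr i))) ∉ G₀.carrier := by
    refine ae_all_iff.2 fun l => ae_all_iff.2 fun k => hη.ae_forall_point_notMem fun j => ?_
    exact measurable_spanSection
      (fun a => measurable_commonPoint fun b => measurable_pi_apply (Sum.inl (a, b)))
      (fun i => measurable_pi_apply (Sum.inr i)) j
  filter_upwards [key] with ω hω
  intro G₀ hG₀ S hS hSη T hT hTη x hx hxT huniq
  obtain ⟨k, G, rfl⟩ := hT.fin_embedding
  simp only [forall_mem_range] at hxT huniq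
  -- Thinning `S` to an affinely independent set with the same span makes the linear system uniquely
  -- solvable.
  obtain ⟨t, htS, hspan, hind⟩ := exists_affineIndependent ℝ (E d) S
  obtain ⟨l, y, rfl⟩ := (hS.subset htS).fin_embedding
  have hy : AffineIndependent ℝ y :=
    hind.comp_embedding (Equiv.ofInjective y y.injective).toEmbedding
  rw [← hspan] at hx huniq
  have hpts (a : Fin l) := hSη (htS (mem_range_self a))
  choose F hF hFy using hpts
  have hmem (i : (Fin l × Fin d) ⊕ Fin k) :
      Sum.elim (fun q => F q.1 q.2) G i ∈ η ω \ {G₀} := by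
    rcases i with q | i
    exacts [hF _ _, hTη (mem_range_self i)]
  have h := hω _ _ (Sum.elim (fun q => F q.1 q.2) G) (fun i => (hmem i).1) G₀ hG₀
    (by rintro ⟨i, hi⟩; exact (hmem i).2 hi)
  simp only [Sum.elim_inl, Sum.elim_inr] at h
  have hcp : (fun a => commonPoint fun b => F a b) = fun a => (y a).ofLp :=
    funext fun a => commonPoint_eq (hFy a)
  rwa [hcp, spanSection_eq hy hx hxT huniq] at h

end Points

/-! ### Hyperplanes as affine subspaces -/

section Affine

variable {d : ℕ}

/-- A hyperplane as an affine subspace. -/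
noncomputable def Hyperplane.toAffineSubspace (H : Hyperplane d) : AffineSubspace ℝ (E d) :=
  AffineSubspace.mk' (H.offset • H.normal) (ℝ ∙ H.normal)ᗮ

lemma Hyperplane.mem_toAffineSubspace (H : Hyperplane d) {x : E d} :
    x ∈ H.toAffineSubspace ↔ x ∈ H.carrier := by
  rw [toAffineSubspace, AffineSubspace.mem_mk', Submodule.mem_orthogonal_singleton_iff_inner_left,
    H.mem_carrier, vsub_eq_sub, inner_sub_left, inner_smul_left, H.inner_normal_self, sub_eq_zero]
  simp

lemma Hyperplane.coe_toAffineSubspace (H : Hyperplane d) :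
    (H.toAffineSubspace : Set (E d)) = H.carrier :=
  Set.ext fun _ => H.mem_toAffineSubspace

lemma Hyperplane.finrank_direction_add_one (H : Hyperplane d) :
    Module.finrank ℝ H.toAffineSubspace.direction + 1 = d := by
  have h := Submodule.finrank_add_finrank_orthogonal (ℝ ∙ H.normal)
  rw [finrank_span_singleton H.normal_ne_zero, finrank_euclideanSpace_fin] at h
  rw [toAffineSubspace, AffineSubspace.direction_mk', add_comm]
  exact h

lemma Hyperplane.affineSpan_eq (H : Hyperplane d) {x : Fin d → E d}
    (hx : AffineIndependent ℝ x) (hxH : ∀ i, x i ∈ H.carrier) :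
    affineSpan ℝ (range x) = H.toAffineSubspace := by
  refine hx.affineSpan_eq_of_le_of_card_eq_finrank_add_one ?_ ?_
  · rw [affineSpan_le, H.coe_toAffineSubspace]
    exact range_subset_iff.2 hxH
  · rw [H.finrank_direction_add_one, Fintype.card_fin]

lemma Hyperplane.eq_of_affineIndependent {H G : Hyperplane d} {x : Fin d → E d}
    (hx : AffineIndependent ℝ x) (hxH : ∀ i, x i ∈ H.carrier) (hxG : ∀ i, x i ∈ G.carrier) :
    H = G := by
  apply Hyperplane.carrier_injective
  rw [← H.coe_toAffineSubspace, ← G.coe_toAffineSubspace, ← H.affineSpan_eq hx hxH,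
    ← G.affineSpan_eq hx hxG]

/-- A vector orthogonal to all normals would translate `x` within the intersection, so the `d`
normals span and form a basis. -/
lemma injective_of_iInter_eq_singleton {F : Fin d → Hyperplane d} {x : E d}
    (h : ⋂ i, (F i).carrier = {x}) : Function.Injective F := by
  have hx (i : Fin d) : ⟪x, (F i).normal⟫_ℝ = (F i).offset :=
    (F i).mem_carrier.1 (mem_iInter.1 (h ▸ mem_singleton x) i)
  have hspan : Submodule.span ℝ (range fun i => (F i).normal) = ⊤ := by
    rw [← Submodule.orthogonal_eq_bot_iff, Submodule.eq_bot_iff]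
    intro v hv
    have hmem : x + v ∈ ⋂ i, (F i).carrier := by
      refine mem_iInter.2 fun i => (F i).mem_carrier.2 ?_
      rw [inner_add_left, hx, Submodule.inner_left_of_mem_orthogonal
        (Submodule.subset_span (mem_range_self i)) hv, add_zero]
    rwa [h, mem_singleton_iff, add_eq_left] at hmem
  have hli := linearIndependent_of_top_le_span_of_card_eq_finrank hspan.ge (by simp)
  exact fun i j hij => hli.injective (by simp only [hij])

/-- If finitely many hyperplanes meet an affine subspace in a single point, and there are more of
them than the dimension of the subspace, then one of the hyperplanes can be omitted. -/
lemma exists_omit {ι : Type*} [Fintype ι] {G : ι → Hyperplane d} {W : AffineSubspace ℝ (E d)}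
    {x : E d} (hxW : x ∈ W) (hxG : ∀ i, x ∈ (G i).carrier)
    (huniq : ∀ z ∈ W, (∀ i, z ∈ (G i).carrier) → z = x)
    (hcard : Module.finrank ℝ W.direction < Fintype.card ι) :
    ∃ i, ∀ z ∈ W, (∀ j, j ≠ i → z ∈ (G j).carrier) → z = x := by
  by_contra! hcon
  -- If no hyperplane is redundant, `z i` lies on all of them except `G i`. The vectors `z i - x`
  -- are then dual to the normals up to nonzero factors, giving too many independent vectors in
  -- `W.direction`.
  choose z hzW hzG hzx using hcon
  let v : ι → W.direction := fun i => ⟨z i - x, AffineSubspace.vsub_mem_direction (hzW i) hxW⟩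
  refine absurd (LinearIndependent.fintype_card_le_finrank (R := ℝ) (b := v) ?_) hcard.not_ge
  have hinner {i j : ι} (hij : j ≠ i) : ⟪z i - x, (G j).normal⟫_ℝ = 0 := by
    rw [inner_sub_left, (G j).mem_carrier.1 (hzG i j hij), (G j).mem_carrier.1 (hxG j), sub_self]
  refine Fintype.linearIndependent_iff.2 fun g hg i => ?_
  have hg' : ∑ j, g j • (z j - x) = 0 := by
    simpa [v] using congrArg (Subtype.val) hg
  have h := congrArg (fun y => ⟪y, (G i).normal⟫_ℝ) hg'
  simp only [sum_inner, inner_smul_left, inner_zero_left] at h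
  rw [Finset.sum_eq_single i (fun j _ hj => by rw [hinner hj.symm, mul_zero]) (by simp)] at h
  refine (mul_eq_zero.1 h).resolve_right fun h0 => hzx i (huniq _ (hzW i) fun j => ?_)
  by_cases hj : j = i
  · rw [hj, (G i).mem_carrier, ← (G i).mem_carrier.1 (hxG i), ← sub_eq_zero, ← inner_sub_left, h0]
  · exact hzG i j hj

lemma exists_embedding_of_le_card {n k : ℕ} {s : Finset (Fin n)} (h : k ≤ s.card) :
    ∃ f : Fin k ↪ Fin n, ∀ a, f a ∈ s := by
  obtain ⟨t, hts, ht⟩ := Finset.exists_subset_card_eq h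
  exact ⟨(t.orderEmbOfFin ht).toEmbedding, fun a => hts (t.orderEmbOfFin_mem ht a)⟩

lemma mem_intersectionPoints_diff_singleton {η : Set (Hyperplane d)} {G : Hyperplane d}
    {x : E d} (hx : x ∈ intersectionPoints η) (hxG : x ∉ G.carrier) :
    x ∈ intersectionPoints (η \ {G}) := by
  obtain ⟨F, hF, hFx⟩ := hx
  refine ⟨F, fun i => ⟨hF i, fun h => hxG ?_⟩, hFx⟩
  rw [← mem_singleton_iff.1 h]
  exact mem_iInter.1 (hFx ▸ mem_singleton x) i

/-- A hyperplane that contains `2d-1` intersection points of `η` in general hyperplane position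
belongs to `η`. -/
theorem NoCoincidence.mem_of_generalHyperplanePosition {η : Set (Hyperplane d)}
    (hη : NoCoincidence η) (hd : 2 ≤ d) {H : Hyperplane d} {x : Fin (2 * d - 1) → E d}
    (hx : ∀ i, x i ∈ intersectionPoints η) (hxH : ∀ i, x i ∈ H.carrier)
    (hgp : GeneralHyperplanePosition x) : H ∈ η := by
  classical
  by_contra hH
  -- `d` common affinely independent points would force `H = G`, so at least `(2d-1) - (d-1) = d`
  -- points avoid `G`.
  have havoid (G : Hyperplane d) (hG : G ∈ η) :
      ∃ f : Fin d ↪ Fin (2 * d - 1), ∀ a, x (f a) ∉ G.carrier := by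
    have hlt : (Finset.univ.filter fun i => x i ∈ G.carrier).card < d := by
      by_contra! hle
      obtain ⟨f, hf⟩ := exists_embedding_of_le_card hle
      have hHG : H = G := Hyperplane.eq_of_affineIndependent (hgp.1 f) (fun i => hxH _)
        fun i => (Finset.mem_filter.1 (hf i)).2
      exact hH (hHG ▸ hG)
    have hsum := Finset.card_filter_add_card_filter_not (s := (Finset.univ : Finset (Fin (2 * d - 1))))
      fun i => x i ∈ G.carrier
    rw [Finset.card_univ, Fintype.card_fin] at hsum
    obtain ⟨f, hf⟩ := exists_embedding_of_le_card (k := d)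
      (s := Finset.univ.filter fun i => x i ∉ G.carrier) (by omega)
    exact ⟨f, fun a => (Finset.mem_filter.1 (hf a)).2⟩
  let f₀ : Fin d ↪ Fin (2 * d - 1) := Fin.castLEEmb (by omega)
  let y : E d := x (f₀ ⟨0, by omega⟩)
  obtain ⟨F, hF, hFy⟩ := hx (f₀ ⟨0, by omega⟩)
  have hyF (i : Fin d) : y ∈ (F i).carrier := mem_iInter.1 (hFy ▸ mem_singleton y) i
  have hyW : y ∈ affineSpan ℝ (range (x ∘ f₀)) := mem_affineSpan ℝ ⟨⟨0, by omega⟩, rfl⟩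
  obtain ⟨i, hi⟩ := exists_omit hyW hyF
    (fun z _ hz => by
      have : z ∈ ⋂ i, (F i).carrier := mem_iInter.2 hz
      rwa [hFy] at this)
    (by
      have := finrank_vectorSpan_range_le ℝ (x ∘ f₀) (n := d - 1) (by simp; omega)
      rw [direction_affineSpan, Fintype.card_fin]
      omega)
  obtain ⟨f, hf⟩ := havoid (F i) (hF i)
  -- General position lets the span be generated by `d` points avoiding the redundant `F i`.
  rw [hgp.2 f₀ f] at hyW hi
  refine hη (F i) (hF i) (range (x ∘ f)) (finite_range _) ?_ (F '' {i}ᶜ) (toFinite _) ?_ y hyW ?_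
    ?_ (hyF i)
  · rintro _ ⟨a, rfl⟩
    exact mem_intersectionPoints_diff_singleton (hx _) (hf a)
  · rintro _ ⟨j, hj, rfl⟩
    exact ⟨hF j, fun h => hj (injective_of_iInter_eq_singleton hFy h)⟩
  · rintro _ ⟨j, -, rfl⟩
    exact hyF j
  · exact fun z hz hzF => hi z hz fun j hj => hzF _ ⟨j, hj, rfl⟩

end Affine

/-! ### Half-spaces and vertices of polytope sections -/

section Polytope

variable {d : ℕ}

lemma exists_halfSpace_eq {K : Set (E d)} (hKne : K.Nonempty) (hKconv : Convex ℝ K)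
    {H : Hyperplane d} (hH : H.carrier ∩ K = ∅) :
    ∃ (u : E d) (s : ℝ), ‖u‖ = 1 ∧ H.carrier = {y | ⟪y, u⟫_ℝ = s} ∧ (∀ z ∈ K, ⟪z, u⟫_ℝ < s) ∧
      halfSpace H K = {y | ⟪y, u⟫_ℝ ≤ s} := by
  have hne {z : E d} (hz : z ∈ K) : z ∉ H.carrier := fun h => by
    have : z ∈ H.carrier ∩ K := ⟨h, hz⟩
    rwa [hH] at this
  -- a segment which leaves an open half-space crosses the bounding hyperplane
  have hcross {u : E d} {s : ℝ} {a b : E d} (ha : ⟪a, u⟫_ℝ < s) (hb : s < ⟪b, u⟫_ℝ) :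
      ∃ t : ℝ, 0 < t ∧ t < 1 ∧ ⟪(1 - t) • a + t • b, u⟫_ℝ = s := by
    have hpos : 0 < ⟪b, u⟫_ℝ - ⟪a, u⟫_ℝ := by linarith
    refine ⟨(s - ⟪a, u⟫_ℝ) / (⟪b, u⟫_ℝ - ⟪a, u⟫_ℝ), by apply div_pos <;> linarith,
      (div_lt_one hpos).2 (by linarith), ?_⟩
    rw [inner_add_left, real_inner_smul_left, real_inner_smul_left]
    field_simp
    ring
  obtain ⟨z₀, hz₀⟩ := hKne
  obtain ⟨u, s, hu, hHu, hz₀u⟩ : ∃ (u : E d) (s : ℝ), ‖u‖ = 1 ∧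
      H.carrier = {y | ⟪y, u⟫_ℝ = s} ∧ ⟪z₀, u⟫_ℝ < s := by
    have hcar : H.carrier = {y | ⟪y, H.normal⟫_ℝ = H.offset} := Set.ext fun y => H.mem_carrier
    rcases lt_or_gt_of_ne (fun h => hne hz₀ (H.mem_carrier.2 h)) with h | h
    · exact ⟨H.normal, H.offset, H.norm_normal, hcar, h⟩
    · refine ⟨-H.normal, -H.offset, by rw [norm_neg, H.norm_normal], ?_, ?_⟩
      · simpa only [inner_neg_right, neg_inj] using hcar
      · rw [inner_neg_right]
        exact neg_lt_neg h
  have hK : ∀ z ∈ K, ⟪z, u⟫_ℝ < s := by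
    intro z hz
    by_contra! hle
    have hlt : s < ⟪z, u⟫_ℝ := lt_of_le_of_ne hle fun h => hne hz (by rw [hHu]; exact h.symm)
    obtain ⟨t, ht0, ht1, ht⟩ := hcross hz₀u hlt
    refine hne (hKconv hz₀ hz (sub_nonneg.2 ht1.le) ht0.le (by ring)) ?_
    rw [hHu]
    exact ht
  refine ⟨u, s, hu, hHu, hK, Set.ext fun y => ⟨?_, fun hy => ?_⟩⟩
  · rintro ⟨u', s', hHu', hKu', hy⟩
    by_contra hlt
    obtain ⟨t, ht0, ht1, ht⟩ := hcross hz₀u (not_le.1 hlt)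
    have hmem : (1 - t) • z₀ + t • y ∈ H.carrier := by
      rw [hHu]
      exact ht
    rw [hHu'] at hmem
    have hmem : ⟪(1 - t) • z₀ + t • y, (u' : E d)⟫_ℝ = s' := hmem
    have hz₀' : ⟪z₀, (u' : E d)⟫_ℝ < s' :=
      lt_of_le_of_ne (hKu' z₀ hz₀) fun h => hne hz₀ (by rw [hHu']; exact h)
    rw [inner_add_left, real_inner_smul_left, real_inner_smul_left] at hmem
    nlinarith
  · exact ⟨⟨u, by simpa using hu⟩, s, hHu, fun z hz => (hK z hz).le, hy⟩

/-- A sphere is connected in dimension at least two, so a large one, missing the frontier, lies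
inside `C` or outside. It contains the point `‖y‖ • u` outside `C`, hence cannot contain `y ∈ C`. -/
lemma isBounded_of_isBounded_frontier (hd : 2 ≤ d) {C : Set (E d)}
    (hC : Bornology.IsBounded (frontier C)) {u : E d} {s : ℝ} (hu : ‖u‖ = 1)
    (hCu : C ⊆ {y | ⟪y, u⟫_ℝ ≤ s}) : Bornology.IsBounded C := by
  obtain ⟨R, hR⟩ := hC.subset_closedBall 0
  have hrank : 1 < Module.rank ℝ (E d) := by
    rw [← Module.finrank_eq_rank, finrank_euclideanSpace_fin]
    exact_mod_cast hd
  refine (Metric.isBounded_closedBall (x := (0 : E d)) (r := max R s)).subset fun y hy => ?_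
  by_contra hlt
  rw [mem_closedBall_zero_iff, not_le, max_lt_iff] at hlt
  have hpre := isPreconnected_sphere hrank (0 : E d) ‖y‖
  have hout : ‖y‖ • u ∈ Metric.sphere (0 : E d) ‖y‖ ∩ Cᶜ := by
    refine ⟨by simp [norm_smul, hu], fun h => ?_⟩
    have h := hCu h
    rw [mem_ofPred_eq, real_inner_smul_left, real_inner_self_eq_norm_sq, hu] at h
    linarith
  have hfr : ∀ w ∈ Metric.sphere (0 : E d) ‖y‖, w ∈ closure C → w ∈ interior C := by
    intro w hw hwC
    by_contra hwi
    have := hR ⟨hwC, hwi⟩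
    rw [mem_closedBall_zero_iff] at this
    rw [mem_sphere_zero_iff_norm] at hw
    linarith [hlt.1]
  obtain ⟨w, -, hwi, hwc⟩ := hpre (interior C) (closure C)ᶜ isOpen_interior
    isClosed_closure.isOpen_compl
    (fun w hw => (em (w ∈ closure C)).imp (hfr w hw) id)
    ⟨y, by simp, hfr y (by simp) (subset_closure hy)⟩
    ⟨_, hout.1, fun h => hout.2 (interior_subset (hfr _ hout.1 h))⟩
  exact hwc (subset_closure (interior_subset hwi))

/-- A linearly spanning family `n₀, n i` contains a basis which contains `n₀`. -/
lemma exists_basis_selection (hd : 1 ≤ d) {ι : Type*} [Finite ι] {A : Set ι} {n₀ : E d}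
    {n : ι → E d} (h₀ : n₀ ≠ 0)
    (hspan : ∀ v : E d, ⟪v, n₀⟫_ℝ = 0 → (∀ i ∈ A, ⟪v, n i⟫_ℝ = 0) → v = 0) :
    ∃ g : Fin (d - 1) → ι, Function.Injective g ∧ (∀ a, g a ∈ A) ∧
      ∀ v : E d, ⟪v, n₀⟫_ℝ = 0 → (∀ a, ⟪v, n (g a)⟫_ℝ = 0) → v = 0 := by
  classical
  -- `none` stands for `n₀`, so extending `{none}` to a basis keeps `n₀` in it.
  let w : Option ι → E d := fun o => o.elim n₀ n
  have hs : LinearIndepOn ℝ w {none} := LinearIndepOn.singleton h₀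
  obtain ⟨b, hbt, hsb, hspanb, hb⟩ := exists_linearIndepOn_extension hs
    (singleton_subset_iff.2 (mem_insert none (some '' A)))
  have htop : Submodule.span ℝ (w '' b) = ⊤ := by
    rw [← Submodule.orthogonal_eq_bot_iff, Submodule.eq_bot_iff]
    intro v hv
    have hv' (o : Option ι) (ho : o ∈ insert none (some '' A)) : ⟪v, w o⟫_ℝ = 0 :=
      Submodule.inner_left_of_mem_orthogonal (hspanb (mem_image_of_mem w ho)) hv
    exact hspan v (hv' none (mem_insert _ _)) fun i hi =>
      hv' (some i) (mem_insert_of_mem _ (mem_image_of_mem _ hi))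
  have hcard : b.ncard = d := by
    have := Fintype.ofFinite b
    have h := finrank_span_eq_card hb
    have hr : range (fun o : b => w o) = w '' b := by
      rw [image_eq_range]
    rw [hr, htop, finrank_top, finrank_euclideanSpace_fin] at h
    rw [h, ← Nat.card_coe_set_eq, Nat.card_eq_fintype_card]
  have hb0 : b = insert none (some '' (some ⁻¹' b)) := by
    ext o
    rcases o with _ | i
    · simpa using hsb rfl
    · simp
  have hcard' : (some ⁻¹' b).ncard = d - 1 := by
    rw [hb0, ncard_insert_of_notMem (by simp) (toFinite _),
      ncard_image_of_injective _ (Option.some_injective ι)] at hcard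
    omega
  let e : (some ⁻¹' b) ≃ Fin (d - 1) := Finite.equivFinOfCardEq (by
    rw [Nat.card_coe_set_eq, hcard'])
  refine ⟨fun a => (e.symm a : ι), Subtype.val_injective.comp e.symm.injective, fun a => ?_,
    fun v hv₀ hv => ?_⟩
  · have := hbt (e.symm a).2
    simpa using this
  · have hle : Submodule.span ℝ (w '' b) ≤ (ℝ ∙ v)ᗮ := by
      rw [Submodule.span_le]
      rintro _ ⟨o, ho, rfl⟩
      rw [SetLike.mem_coe, Submodule.mem_orthogonal_singleton_iff_inner_right]
      rcases o with _ | i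
      · exact hv₀
      · have := hv (e ⟨i, ho⟩)
        simp only [e.symm_apply_apply] at this
        exact this
    rw [htop, top_le_iff, Submodule.orthogonal_eq_top_iff] at hle
    simpa using hle

/-- A hyperplane which meets a convex body `K` contains a point of the boundary of a polytope
`⋂ i, G_i(K)` that is determined by the hyperplane and `d - 1` of the `G_i`. -/
theorem exists_vertex (hd : 2 ≤ d) {K : Set (E d)} (hKne : K.Nonempty) (hKconv : Convex ℝ K)
    {H : Hyperplane d} (hH : H ∈ hitting K) {k : ℕ} (hk : 1 ≤ k) {G : Fin k → Hyperplane d}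
    (hG : ∀ i, (G i).carrier ∩ K = ∅)
    (hbdd : Bornology.IsBounded (frontier (⋂ i, halfSpace (G i) K))) :
    ∃ x ∈ frontier (⋂ i, halfSpace (G i) K), x ∈ H.carrier ∧ ∃ g : Fin (d - 1) → Fin k,
      Function.Injective g ∧ (∀ a, x ∈ (G (g a)).carrier) ∧
        ∀ z ∈ H.carrier, (∀ a, z ∈ (G (g a)).carrier) → z = x := by
  choose u s hu hGu hKu hhalf using fun i => exists_halfSpace_eq hKne hKconv (hG i)
  have hP : ⋂ i, halfSpace (G i) K = {y | ∀ i, ⟪y, u i⟫_ℝ ≤ s i} := by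
    ext y
    simp [hhalf]
  rw [hP] at hbdd ⊢
  set C : Set (E d) := {y | ∀ i, ⟪y, u i⟫_ℝ ≤ s i} with hC
  have hGmem (i : Fin k) {y : E d} : y ∈ (G i).carrier ↔ ⟪y, u i⟫_ℝ = s i := by
    rw [hGu]
    rfl
  have hCbdd : Bornology.IsBounded C :=
    isBounded_of_isBounded_frontier hd hbdd (hu ⟨0, hk⟩) fun y hy => hy _
  have hHC : IsCompact (H.carrier ∩ C) := by
    refine Metric.isCompact_of_isClosed_isBounded ?_ (hCbdd.subset inter_subset_right)
    refine IsClosed.inter ?_ ?_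
    · have : H.carrier = {y | ⟪y, H.normal⟫_ℝ = H.offset} := Set.ext fun y => H.mem_carrier
      rw [this]
      exact isClosed_eq (by fun_prop) (by fun_prop)
    · simp only [hC, ofPred_forall]
      exact isClosed_iInter fun i => isClosed_le (by fun_prop) (by fun_prop)
  obtain ⟨y, hyH, hyK⟩ := hH
  obtain ⟨x, hx⟩ := hHC.extremePoints_nonempty ⟨y, hyH, fun i => (hKu i y hyK).le⟩
  obtain ⟨⟨hxH, hxC⟩, hext⟩ := mem_extremePoints.1 hx
  -- A direction tangent to `H` and to all active constraints could be followed a little both ways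
  -- inside the section, contradicting extremality.
  have hspan : ∀ v : E d, ⟪v, H.normal⟫_ℝ = 0 →
      (∀ i ∈ {i | x ∈ (G i).carrier}, ⟪v, (G i).normal⟫_ℝ = 0) → v = 0 := by
    intro v hvH hvG
    have hev : ∀ᶠ t : ℝ in nhds 0, x + t • v ∈ H.carrier ∩ C := by
      have hC' : ∀ᶠ t : ℝ in nhds 0, ∀ i, ⟪x + t • v, u i⟫_ℝ ≤ s i := by
        refine Filter.eventually_all.2 fun i => ?_
        by_cases hi : x ∈ (G i).carrier
        · refine Filter.Eventually.of_forall fun t => le_of_eq ?_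
          rw [← hGmem, (G i).mem_carrier, inner_add_left, real_inner_smul_left, hvG i hi, mul_zero,
            add_zero, ← (G i).mem_carrier]
          exact hi
        · have hlt : ⟪x + (0 : ℝ) • v, u i⟫_ℝ < s i := by
            rw [zero_smul, add_zero]
            exact lt_of_le_of_ne (hxC i) fun h => hi ((hGmem i).2 h)
          have hcont : Continuous fun t : ℝ => ⟪x + t • v, u i⟫_ℝ := by fun_prop
          exact (hcont.continuousAt.eventually_lt continuousAt_const hlt).mono fun t ht => ht.le
      filter_upwards [hC'] with t ht
      refine ⟨?_, ht⟩
      rw [H.mem_carrier, inner_add_left, real_inner_smul_left, hvH, mul_zero, add_zero,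
        ← H.mem_carrier]
      exact hxH
    have hneg : ∀ᶠ t : ℝ in nhds 0, x + (-t) • v ∈ H.carrier ∩ C := by
      have : Filter.Tendsto (fun t : ℝ => -t) (nhds 0) (nhds 0) := by
        simpa using (continuous_neg (G := ℝ)).tendsto 0
      exact this.eventually hev
    obtain ⟨t, ⟨ht1, ht2⟩, ht0⟩ :=
      (((hev.and hneg).filter_mono nhdsWithin_le_nhds).and
        (self_mem_nhdsWithin (s := Ioi (0 : ℝ)))).exists
    have hseg : x ∈ openSegment ℝ (x + t • v) (x + (-t) • v) := by
      refine ⟨1 / 2, 1 / 2, by norm_num, by norm_num, by norm_num, ?_⟩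
      module
    have := (hext _ ht1 _ ht2 hseg).1
    rw [add_eq_left, smul_eq_zero] at this
    exact this.resolve_left (ne_of_gt ht0)
  obtain ⟨g, hg, hgA, hguniq⟩ := exists_basis_selection (by omega) H.normal_ne_zero hspan
  refine ⟨x, ⟨subset_closure hxC, fun hint => ?_⟩, hxH, g, hg, hgA, fun z hzH hzG => ?_⟩
  · let i := g ⟨0, by omega⟩
    have hcont : Continuous fun t : ℝ => x + t • u i := by fun_prop
    have hnhds : C ∈ nhds (x + (0 : ℝ) • u i) := by
      simpa using mem_interior_iff_mem_nhds.1 hint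
    have hev : ∀ᶠ t : ℝ in nhds 0, x + t • u i ∈ C := hcont.continuousAt hnhds
    obtain ⟨t, ht, ht0⟩ := ((hev.filter_mono nhdsWithin_le_nhds).and
      (self_mem_nhdsWithin (s := Ioi (0 : ℝ)))).exists
    have h := ht i
    rw [inner_add_left, real_inner_smul_left, real_inner_self_eq_norm_sq, hu,
      (hGmem i).1 (hgA _)] at h
    have ht0 : 0 < t := ht0
    linarith
  · refine sub_eq_zero.1 (hguniq (z - x) ?_ fun a => ?_)
    · rw [inner_sub_left, H.mem_carrier.1 hzH, H.mem_carrier.1 hxH, sub_self]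
    · rw [inner_sub_left, (G _).mem_carrier.1 (hzG a), (G _).mem_carrier.1 (hgA a), sub_self]

end Polytope

/-! ### Correctness of the reconstruction -/

section Reconstruction

variable {d : ℕ}

lemma exists_mem_affineSpan_of_not_affineIndependent {V ι : Type*} [AddCommGroup V] [Module ℝ V]
    [Fintype ι] {p : ι → V} (hp : ¬ AffineIndependent ℝ p) :
    ∃ a, p a ∈ affineSpan ℝ (p '' {a}ᶜ) := by
  classical
  rw [affineIndependent_iff_of_fintype] at hp
  push Not at hp
  obtain ⟨w, hw, hwp, a, ha⟩ := hp
  refine ⟨a, ?_⟩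
  rw [Finset.weightedVSub_eq_linear_combination (hw := hw)] at hwp
  have hsum : ∑ b, (if b = a then 0 else -w b / w a) = 1 := by
    rw [Fintype.sum_eq_add_sum_compl a] at hw ⊢
    have h : ∀ b ∈ ({a}ᶜ : Finset ι), (if b = a then 0 else -w b / w a) = -w b / w a :=
      fun b hb => if_neg (by simpa using hb)
    rw [Finset.sum_congr rfl h, ← Finset.sum_div, Finset.sum_neg_distrib, if_pos rfl]
    field_simp
    linarith
  have hmem := affineCombination_mem_affineSpan_image (s := Finset.univ) hsum (s' := {a}ᶜ)
    (fun b _ hb => if_pos (by simpa using hb)) p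
  convert hmem
  rw [Finset.affineCombination_eq_linear_combination _ _ _ hsum]
  rw [Fintype.sum_eq_add_sum_compl a] at hwp ⊢
  have h : ∀ b ∈ ({a}ᶜ : Finset ι), (if b = a then 0 else -w b / w a) • p b =
      (-(w a)⁻¹) • (w b • p b) := fun b hb => by
    rw [if_neg (by simpa using hb), smul_smul]
    congr 1
    ring
  rw [Finset.sum_congr rfl h, ← Finset.smul_sum, if_pos rfl, zero_smul, zero_add,
    eq_neg_of_add_eq_zero_right hwp, neg_smul_neg, smul_smul, inv_mul_cancel₀ ha, one_smul]

lemma mem_intersectionPoints_of_insert (hd : 1 ≤ d) {η : Set (Hyperplane d)} {H : Hyperplane d}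
    {F : Fin (d - 1) → Hyperplane d} {x : E d} (hH : H ∈ η) (hF : ∀ a, F a ∈ η)
    (hxH : x ∈ H.carrier) (hxF : ∀ a, x ∈ (F a).carrier)
    (huniq : ∀ z ∈ H.carrier, (∀ a, z ∈ (F a).carrier) → z = x) : x ∈ intersectionPoints η := by
  obtain ⟨e, rfl⟩ : ∃ e, d = e + 1 := ⟨d - 1, by omega⟩
  refine ⟨Fin.cons H F, Fin.cases hH hF, ?_⟩
  ext z
  simp only [mem_iInter, Fin.forall_fin_succ, Fin.cons_zero, Fin.cons_succ, mem_singleton_iff]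
  refine ⟨fun h => huniq z h.1 h.2, ?_⟩
  rintro rfl
  exact ⟨hxH, hxF⟩

/-- Points of a hyperplane `H ∈ η` which are determined by `H` and pairwise disjoint families of
other hyperplanes of `η` are in general hyperplane position. -/
theorem NoCoincidence.affineIndependent_of_sections {η : Set (Hyperplane d)}
    (hη : NoCoincidence η) (hd : 2 ≤ d) {H : Hyperplane d} (hH : H ∈ η)
    {G : Fin d → Fin (d - 1) → Hyperplane d} (hG : ∀ b a, G b a ∈ η) (hGH : ∀ b a, G b a ≠ H)
    (hinj : ∀ b b' a a', G b a = G b' a' → b = b' ∧ a = a') {x : Fin d → E d}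
    (hxH : ∀ b, x b ∈ H.carrier) (hxG : ∀ b a, x b ∈ (G b a).carrier)
    (huniq : ∀ b, ∀ z ∈ H.carrier, (∀ a, z ∈ (G b a).carrier) → z = x b) :
    AffineIndependent ℝ x := by
  by_contra hx
  obtain ⟨c, hc⟩ := exists_mem_affineSpan_of_not_affineIndependent hx
  have hWH {z : E d} (hz : z ∈ affineSpan ℝ (x '' {c}ᶜ)) : z ∈ H.carrier := by
    rw [← H.mem_toAffineSubspace]
    refine affineSpan_le.2 ?_ hz
    rintro _ ⟨b, -, rfl⟩
    exact H.mem_toAffineSubspace.2 (hxH b)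
  have hrank : Module.finrank ℝ (affineSpan ℝ (x '' {c}ᶜ)).direction < d - 1 := by
    classical
    have h := finrank_vectorSpan_image_finset_le ℝ x ({c}ᶜ : Finset (Fin d)) (n := d - 2)
      (by rw [Finset.card_compl, Finset.card_singleton, Fintype.card_fin]; omega)
    rw [Finset.coe_image, Finset.coe_compl, Finset.coe_singleton] at h
    rw [direction_affineSpan]
    omega
  -- The `d-1` hyperplanes exceed the dimension of the span of the other points. The omitted `G c i`
  -- occurs in no other family, so these points do not depend on it.
  obtain ⟨i, hi⟩ := exists_omit hc (hxG c) (fun z hz => huniq c z (hWH hz))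
    (by rwa [Fintype.card_fin])
  refine hη (G c i) (hG c i) (x '' {c}ᶜ) (toFinite _) ?_ (G c '' {i}ᶜ) (toFinite _) ?_ (x c) hc
    ?_ ?_ (hxG c i)
  · rintro _ ⟨b, hb, rfl⟩
    exact mem_intersectionPoints_of_insert (by omega) ⟨hH, (hGH c i).symm⟩
      (fun a => ⟨hG b a, fun h => hb (hinj _ _ _ _ h).1⟩) (hxH b) (hxG b) (huniq b)
  · rintro _ ⟨a, ha, rfl⟩
    exact ⟨hG c a, fun h => ha (hinj _ _ _ _ h).2⟩
  · rintro _ ⟨a, -, rfl⟩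
    exact hxG c a
  · exact fun z hz hzG => hi z hz fun j hj => hzG _ ⟨j, hj, rfl⟩

lemma injective_of_forall_affineIndependent (hd : 2 ≤ d) {n : ℕ} (hn : d ≤ n) {x : Fin n → E d}
    (hx : ∀ f : Fin d ↪ Fin n, AffineIndependent ℝ (x ∘ f)) : Function.Injective x := by
  classical
  intro i j hij
  obtain ⟨s, hs, hcard⟩ := Finset.exists_superset_card_eq (s := {i, j}) (n := d)
    (Finset.card_le_two.trans hd) (by simpa using hn)
  have hmem (k : Fin n) (hk : k ∈ s) : ∃ a, s.orderEmbOfFin hcard a = k := by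
    have : k ∈ range (s.orderEmbOfFin hcard) := by
      rwa [Finset.range_orderEmbOfFin]
    exact this
  obtain ⟨a, ha⟩ := hmem i (hs (by simp))
  obtain ⟨b, hb⟩ := hmem j (hs (by simp))
  have hab : a = b := (hx (s.orderEmbOfFin hcard).toEmbedding).injective (by
    simpa [ha, hb] using hij)
  rw [← ha, ← hb, hab]

lemma isBounded_outerParallel {K : Set (E d)} (hK : Bornology.IsBounded K) {r : ℝ≥0∞}
    (hr : r < ∞) : Bornology.IsBounded (outerParallel K r) := by
  refine (hK.cthickening (δ := r.toReal)).subset fun x hx => ?_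
  rw [Metric.mem_cthickening_iff, ENNReal.ofReal_toReal hr.ne]
  exact hx.2

/-- If the stopping criterion holds at a finite time, then exactly the hyperplanes of `η` that hit
`K` are returned. -/
theorem NoCoincidence.returned_eq {η : Set (Hyperplane d)} (hη : NoCoincidence η) (hd : 2 ≤ d)
    {K : Set (E d)} (hKne : K.Nonempty) (hKconv : Convex ℝ K) (hKcomp : IsCompact K) {n : ℕ}
    (hcrit : StopsAt K (intersectionPoints η) n)
    (hfin : scanTime K (intersectionPoints η) n < ∞) :
    returned K (intersectionPoints η) n = η ∩ hitting K := by
  ext H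
  constructor
  · rintro ⟨hHK, x, -, hx, hgp, hHx⟩
    refine ⟨hη.mem_of_generalHyperplanePosition hd (fun i => (hx i).1) (fun i => ?_) hgp, hHK⟩
    rw [hHx]
    exact mem_affineSpan ℝ (mem_range_self i)
  rintro ⟨hH, hHK⟩
  obtain ⟨-, k, hk, G, hG, hGinj, hGfr⟩ := hcrit
  have hGη (j) (i) : G j i ∈ η := by
    obtain ⟨-, x, -, hx, hxG, hgp⟩ := hG j i
    exact hη.mem_of_generalHyperplanePosition hd (fun i => (hx i).1) hxG hgp
  have hGH (j) (i) : G j i ≠ H := by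
    intro h
    have hemp := (hG j i).1
    rw [h] at hemp
    exact hHK.ne_empty hemp
  -- Finiteness of the scan time bounds the frontiers; without it `outerParallel` could be all of
  -- `Kᶜ`.
  have hvertex (j) := exists_vertex hd hKne hKconv hHK (hk j) (fun i => (hG j i).1)
    ((isBounded_outerParallel hKcomp.isBounded hfin).subset (hGfr j))
  choose x hxfr hxH g hg hxG huniq using hvertex
  have hind (f : Fin d ↪ Fin (2 * d - 1)) : AffineIndependent ℝ (x ∘ f) := by
    refine hη.affineIndependent_of_sections hd hH (G := fun b a => G (f b) (g (f b) a))
      (fun b a => hGη _ _) (fun b a => hGH _ _) (fun b b' a a' h => ?_) (fun b => hxH _)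
      (fun b a => hxG _ a) (fun b => huniq _)
    have h := @hGinj ⟨f b, g (f b) a⟩ ⟨f b', g (f b') a'⟩ h
    have hb : b = b' := f.injective (congrArg Sigma.fst h)
    subst hb
    exact ⟨rfl, hg _ (eq_of_heq (Sigma.mk.inj h).2)⟩
  have hspan (f : Fin d ↪ Fin (2 * d - 1)) :
      affineSpan ℝ (range (x ∘ f)) = H.toAffineSubspace :=
    H.affineSpan_eq (hind f) fun b => hxH _
  refine ⟨hHK, x, injective_of_forall_affineIndependent hd (by omega) hind, fun j => ⟨?_, ?_⟩,
    ⟨hind, fun f f' => (hspan f).trans (hspan f').symm⟩, ?_⟩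
  · exact mem_intersectionPoints_of_insert (by omega) hH (fun a => hGη j (g j a)) (hxH j) (hxG j)
      (huniq j)
  · exact hGfr j (hxfr j)
  · rw [← H.coe_toAffineSubspace]
    refine congrArg _ (le_antisymm ?_ ?_)
    · rw [← hspan (Fin.castLEEmb (by omega))]
      exact affineSpan_mono ℝ (range_comp_subset_range _ _)
    · rw [affineSpan_le, H.coe_toAffineSubspace]
      exact range_subset_iff.2 hxH

end Reconstruction

end HyperplaneProcess

theorem proposition3p2 {Ω : Type*} [MeasurableSpace Ω] (P : Measure Ω) [IsProbabilityMeasure P]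
    (d : ℕ) (hd : 2 ≤ d)
    (γ : ℝ) (hγ : 0 < γ)
    (Q : Measure (HyperplaneProcess.UnitSphere d))
    (hQ : HyperplaneProcess.IsDirectionalDistribution Q)
    (η : Ω → Set (HyperplaneProcess.Hyperplane d))
    (hη : HyperplaneProcess.IsPoissonProcess P η (HyperplaneProcess.intensityMeasure γ Q))
    (K : Set (HyperplaneProcess.E d)) (hKne : K.Nonempty) (hKconv : Convex ℝ K)
    (hKcomp : IsCompact K) :
    ∀ᵐ ω ∂P,
      HyperplaneProcess.runningTime K (HyperplaneProcess.intersectionPoints (η ω)) < ∞ →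
        HyperplaneProcess.output K (HyperplaneProcess.intersectionPoints (η ω)) =
          η ω ∩ HyperplaneProcess.hitting K := by
  classical
  have := hQ.isProbability
  filter_upwards [hη.ae_noCoincidence] with ω hω hT
  unfold HyperplaneProcess.runningTime at hT
  unfold HyperplaneProcess.output
  -- `T < ∞` excludes both an algorithm that never stops and a stopping stage whose scan time is
  -- `∞`.
  split_ifs at hT with h
  · rw [dif_pos h]
    exact hω.returned_eq hd hKne hKconv hKcomp (Nat.find_spec h) hT
  · exact absurd hT (lt_irrefl _)
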